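/- Let $\mathcal S=\{S_m,\ m\in\mathcal M\}$ be a finite collection of linear subspaces of $\mathbb R^n$. For $m\in\mathcal M$ write $D_m=\dim S_m$ and $N_m=n-D_m$. Let $\mathcal L=\{L_m,\ m\in\mathcal M\}$ be nonnegative numbers and let $K_1,K_2$ be real numbers with $K_2\ge K_1>1$. For integers $D\ge 1$ and $N\ge 3$, let $F_{D,N}$ be a Fisher random variable with $D$ and $N$ degrees of freedom, and for $x\ge 0$ set $$\mathrm{Fish}[D,N,x]=\frac{\mathbb E[(F_{D,N}-x)_+]}{\mathbb E[F_{D,N}]}.$$ For $0<q\le 1$ let $\mathrm{EFish}[D,N,q]$ be the unique $x\ge 0$ such that $\mathrm{Fish}[D,N,x]=q$. The Kullback-type penalty is $$\mathrm{pen}^{\mathcal K}_{K_1,K_2,\mathcal L}(m)=\frac{K_2}{K_2-1}\left[\frac{K_1(D_m+1)N_m}{N_m-1}\,\mathrm{EFish}\big[D_m+1,N_m-1,e^{-L_m}\big]-D_m\right]_+ .$$ Let $m\in\mathcal M$ with $D_m\ge 1$ and $N_m\ge 9$. Set $D=D_m+1$, $N=N_m-1$ and $$\Delta'=\frac{L_m+\log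 5+1/(N-2)}{1-5/(N-2)}.$$ Then $$\mathrm{pen}^{\mathcal K}_{K_1,K_2,\mathcal L}(m)\le\frac{K_1K_2}{K_2-1}\,\frac{N+1}{N-2}\left[1+e^{2\Delta'/N}\sqrt{\left(1+\frac{2D}{N}\right)\frac{2\Delta'}{D}}\,\right]^2D .$$ -/

import Mathlib

open MeasureTheory ProbabilityTheory

namespace GaussianModelSelection

/-- The `χ²` distribution with `d` degrees of freedom: the law of `∑ i, Z i ^ 2`, where the
`d` variables `Z i` are independent standard Gaussian variables. -/
noncomputable def chiSquared (d : ℕ) : Measure ℝ :=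
  (Measure.pi fun _ : Fin d => gaussianReal 0 1).map fun z => ∑ i, z i ^ 2

/-- The Fisher distribution with `D` and `N` degrees of freedom: the law of `(U / D) / (V / N)`,
where `U` and `V` are independent `χ²` variables with `D` and `N` degrees of freedom. -/
noncomputable def fisher (D N : ℕ) : Measure ℝ :=
  ((chiSquared D).prod (chiSquared N)).map fun p => (p.1 / D) / (p.2 / N)

/-- `Fish[D, N, x] = 𝔼[(F - x)₊] / 𝔼[F]`, with `F` a Fisher variable with `D` and `N` degrees of
freedom (`D ≥ 1`, `N ≥ 3`, `x ≥ 0`). -/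
noncomputable def Fish (D N : ℕ) (x : ℝ) : ℝ :=
  (∫ y, max (y - x) 0 ∂fisher D N) / ∫ y, y ∂fisher D N

/-- `EFish[D, N, q]` is the solution `x ≥ 0` of `Fish[D, N, x] = q` when `0 < q ≤ 1`, and `0` by
convention when `q > 1`. The solution exists and is unique for `D ≥ 1` and `N ≥ 3`, see
`existsUnique_Fish_eq`; it is written here as the infimum of the set of solutions. -/
noncomputable def EFish (D N : ℕ) (q : ℝ) : ℝ :=
  if 1 < q then 0 else sInf {x : ℝ | 0 ≤ x ∧ Fish D N x = q}

/-- The Kullback-type penalty of a model of dimension `d` and codimension `c` with weight `l`. -/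
noncomputable def kullbackPenalty (K₁ K₂ : ℝ) (d c : ℕ) (l : ℝ) : ℝ :=
  K₂ / (K₂ - 1) *
    max (K₁ * ((d : ℝ) + 1) * (c : ℝ) / ((c : ℝ) - 1) * EFish (d + 1) (c - 1) (Real.exp (-l))
      - (d : ℝ)) 0

/-- The dimension `D_m` of a model, a linear subspace of `ℝⁿ`. -/
noncomputable def modelDim {n : ℕ} (V : Submodule ℝ (EuclideanSpace ℝ (Fin n))) : ℕ :=
  Module.finrank ℝ V

/-- The codimension `N_m = n - D_m` of a model (`D_m ≤ n` always holds). -/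
noncomputable def modelCodim {n : ℕ} (V : Submodule ℝ (EuclideanSpace ℝ (Fin n))) : ℕ :=
  n - modelDim V

/-- The penalty `m ↦ pen^𝒦_{K₁, K₂, ℒ}(m)` associated to a collection `S` of models and a
collection `L` of weights. -/
noncomputable def penKullback {n : ℕ} {M : Type*}
    (S : M → Submodule ℝ (EuclideanSpace ℝ (Fin n))) (K₁ K₂ : ℝ) (L : M → ℝ) (m : M) : ℝ :=
  kullbackPenalty K₁ K₂ (modelDim (S m)) (modelCodim (S m)) (L m)

/-! Well-posedness of the definition of `EFish`. -/

lemma measurable_sumSq (d : ℕ) : Measurable fun z : Fin d → ℝ => ∑ i, z i ^ 2 := by fun_prop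

instance instIsProbabilityMeasureChiSquared (d : ℕ) : IsProbabilityMeasure (chiSquared d) :=
  Measure.isProbabilityMeasure_map (measurable_sumSq d).aemeasurable

lemma measurable_fisherRatio (D N : ℕ) :
    Measurable fun p : ℝ × ℝ => (p.1 / (D : ℝ)) / (p.2 / (N : ℝ)) := by fun_prop

instance instIsProbabilityMeasureFisher (D N : ℕ) : IsProbabilityMeasure (fisher D N) :=
  Measure.isProbabilityMeasure_map (measurable_fisherRatio D N).aemeasurable

lemma integrable_id_chiSquared (d : ℕ) : Integrable (fun u : ℝ => u) (chiSquared d) := by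
  rw [chiSquared, integrable_map_measure
    (Measurable.aestronglyMeasurable (by fun_prop)) (measurable_sumSq d).aemeasurable]
  refine integrable_finsetSum _ fun i _ => ?_
  have h : Integrable (fun x : ℝ => x ^ 2) (gaussianReal 0 1) :=
    (memLp_id_gaussianReal (μ := 0) (v := 1) 2).integrable_sq
  exact integrable_comp_eval (μ := fun _ : Fin d => gaussianReal 0 1) (i := i) h

lemma integrable_abs_rpow_gaussianReal {s : ℝ} (hs : -1 < s) :
    Integrable (fun x : ℝ => |x| ^ s) (gaussianReal 0 1) := by
  rw [gaussianReal_of_var_ne_zero _ one_ne_zero, integrable_withDensity_iff_integrable_smul'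
    (measurable_gaussianPDF 0 1) (Filter.Eventually.of_forall fun _ => gaussianPDF_lt_top)]
  have h : Integrable (fun x : ℝ => ‖x‖ ^ s * Real.exp (-(1 / 2) * ‖x‖ ^ 2)) volume := by
    rw [integrable_fun_norm_addHaar (E := ℝ) volume
      (f := fun y : ℝ => y ^ s * Real.exp (-(1 / 2) * y ^ 2))]
    simpa using integrableOn_rpow_mul_exp_neg_mul_sq (b := 1 / 2) (by norm_num) hs
  refine (h.const_mul (Real.sqrt (2 * Real.pi))⁻¹).congr
    (Filter.Eventually.of_forall fun x => ?_)
  simp only [toReal_gaussianPDF, gaussianPDFReal, Real.norm_eq_abs, sq_abs, smul_eq_mul,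
    NNReal.coe_one, mul_one, sub_zero]
  rw [show -x ^ 2 / 2 = -(1 / 2) * x ^ 2 by ring]
  ring

lemma integrable_inv_chiSquared {d : ℕ} (hd : 3 ≤ d) :
    Integrable (fun v : ℝ => v⁻¹) (chiSquared d) := by
  have hd0 : (0 : ℝ) < d := by positivity
  have hd3 : (3 : ℝ) ≤ d := by exact_mod_cast hd
  rw [chiSquared, integrable_map_measure
    (Measurable.aestronglyMeasurable (by fun_prop)) (measurable_sumSq d).aemeasurable]
  have hs : -1 < -(2 / (d : ℝ)) := by
    rw [neg_lt_neg_iff, div_lt_one hd0]; linarith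
  have hI : Integrable (fun z : Fin d → ℝ => ∏ i, |z i| ^ (-(2 / (d : ℝ))))
      (Measure.pi fun _ : Fin d => gaussianReal 0 1) :=
    Integrable.fintype_prod fun _ => integrable_abs_rpow_gaussianReal hs
  refine (hI.const_mul (d : ℝ)⁻¹).mono'
    (measurable_inv.comp (measurable_sumSq d)).aestronglyMeasurable ?_
  have hne : ∀ᵐ z ∂(Measure.pi fun _ : Fin d => gaussianReal 0 1), ∀ i, z i ≠ 0 := by
    have := nullSingletonClass_gaussianReal (μ := 0) (v := 1) one_ne_zero
    refine ae_all_iff.2 fun i => ?_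
    exact (Measure.tendsto_eval_ae_ae (μ := fun _ : Fin d => gaussianReal 0 1) (i := i)).eventually
      (Measure.ae_ne (gaussianReal 0 1) 0)
  filter_upwards [hne] with z hz
  have hpos : ∀ i, 0 < |z i| := fun i => abs_pos.2 (hz i)
  have hP : 0 < ∏ i, (z i ^ 2) ^ ((d : ℝ)⁻¹) :=
    Finset.prod_pos fun i _ => Real.rpow_pos_of_pos (by have := hz i; positivity) _
  have hAG := Real.geom_mean_le_arith_mean_weighted Finset.univ (fun _ : Fin d => (d : ℝ)⁻¹)
    (fun i => z i ^ 2) (fun _ _ => by positivity)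
    (by simp [hd0.ne']) (fun _ _ => by positivity)
  rw [← Finset.mul_sum] at hAG
  have hSpos : 0 < ∑ i, z i ^ 2 := by
    have := hP.trans_le hAG
    exact pos_of_mul_pos_right this (by positivity)
  have hprod : ∏ i, |z i| ^ (-(2 / (d : ℝ))) = (∏ i, (z i ^ 2) ^ ((d : ℝ)⁻¹))⁻¹ := by
    rw [← Finset.prod_inv_distrib]
    refine Finset.prod_congr rfl fun i _ => ?_
    rw [Real.rpow_neg (hpos i).le, ← sq_abs, ← Real.rpow_natCast, ← Real.rpow_mul (hpos i).le]
    norm_num [div_eq_mul_inv]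
  simp only [Function.comp_apply]
  rw [Real.norm_of_nonneg (by positivity), hprod, ← mul_inv]
  refine inv_anti₀ (by positivity) ?_
  calc (d : ℝ) * ∏ i, (z i ^ 2) ^ ((d : ℝ)⁻¹) ≤ d * ((d : ℝ)⁻¹ * ∑ i, z i ^ 2) := by gcongr
    _ = ∑ i, z i ^ 2 := by field_simp

lemma integrable_id_fisher (D : ℕ) {N : ℕ} (hN : 3 ≤ N) :
    Integrable (fun y : ℝ => y) (fisher D N) := by
  rw [fisher, integrable_map_measure (by fun_prop) (by fun_prop)]
  have h := ((integrable_id_chiSquared D).mul_prod (integrable_inv_chiSquared hN)).const_mul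
    ((N : ℝ) / D)
  refine h.congr (Filter.Eventually.of_forall fun p => ?_)
  simp only [Function.comp_apply, div_eq_mul_inv, mul_inv, inv_inv]
  ring

lemma fisher_Ioi_pos {D N : ℕ} (hD : 1 ≤ D) (hN : 1 ≤ N) {x : ℝ} (hx : 0 ≤ x) :
    0 < fisher D N (Set.Ioi x) := by
  have hD0 : (0 : ℝ) < D := by exact_mod_cast hD
  have hN0 : (0 : ℝ) < N := by exact_mod_cast hN
  have : (gaussianReal 0 1).IsOpenPosMeasure :=
    (gaussianReal_absolutelyContinuous' 0 one_ne_zero).isOpenPosMeasure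
  rw [fisher, Measure.map_apply (measurable_fisherRatio D N) measurableSet_Ioi, chiSquared,
    chiSquared, Measure.map_prod_map _ _ (measurable_sumSq D) (measurable_sumSq N),
    Measure.map_apply (by fun_prop) (measurable_fisherRatio D N measurableSet_Ioi)]
  let O : Set ((Fin D → ℝ) × (Fin N → ℝ)) :=
    {w | 0 < ∑ i, w.2 i ^ 2} ∩ {w | x * ((∑ i, w.2 i ^ 2) / N) < (∑ i, w.1 i ^ 2) / D}
  have hO : IsOpen O := (isOpen_lt (by fun_prop) (by fun_prop)).inter
    (isOpen_lt (by fun_prop) (by fun_prop))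
  have hne : O.Nonempty := by
    refine ⟨(fun _ => x + 1, fun _ => 1), ?_, ?_⟩
    · simp [hN0]
    · simp only [one_pow, Set.mem_ofPred_eq, Finset.sum_const, Finset.card_univ, Fintype.card_fin,
        nsmul_eq_mul, mul_one]
      rw [div_self hN0.ne', mul_div_cancel_left₀ _ hD0.ne']
      nlinarith
  refine (hO.measure_pos _ hne).trans_le (measure_mono ?_)
  rintro ⟨a, b⟩ ⟨h1, h2⟩
  simp only [Set.mem_ofPred_eq] at h1 h2
  simp only [Set.mem_preimage, Prod.map_apply, Set.mem_Ioi]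
  rw [lt_div_iff₀ (by positivity)]
  exact h2

lemma fisher_ae_nonneg (D N : ℕ) : ∀ᵐ y ∂fisher D N, 0 ≤ y := by
  have h (d : ℕ) : ∀ᵐ u ∂chiSquared d, 0 ≤ u := by
    rw [chiSquared, ae_map_iff (measurable_sumSq d).aemeasurable measurableSet_Ici]
    exact Filter.Eventually.of_forall fun z => by positivity
  rw [fisher, ae_map_iff (by fun_prop) measurableSet_Ici]
  have h1 := (Measure.quasiMeasurePreserving_fst
    (μ := chiSquared D) (ν := chiSquared N)).ae (h D)
  have h2 := (Measure.quasiMeasurePreserving_snd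
    (μ := chiSquared D) (ν := chiSquared N)).ae (h N)
  filter_upwards [h1, h2] with p hp1 hp2
  positivity

lemma integrable_posPart_fisher (D : ℕ) {N : ℕ} (hN : 3 ≤ N) (x : ℝ) :
    Integrable (fun y : ℝ => max (y - x) 0) (fisher D N) :=
  ((integrable_id_fisher D hN).sub (integrable_const x)).pos_part

lemma strictAntiOn_posPart_fisher {D N : ℕ} (hD : 1 ≤ D) (hN : 3 ≤ N) :
    StrictAntiOn (fun x => ∫ y, max (y - x) 0 ∂fisher D N) (Set.Ici 0) := by
  intro a ha b _ hab
  have hi : Integrable (fun y => max (y - a) 0 - max (y - b) 0) (fisher D N) :=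
    (integrable_posPart_fisher D hN a).sub (integrable_posPart_fisher D hN b)
  have h0 : 0 < ∫ y, (max (y - a) 0 - max (y - b) 0) ∂fisher D N := by
    rw [integral_pos_iff_support_of_nonneg (fun y => ?_) hi]
    · refine (fisher_Ioi_pos hD (by lia) (x := a) ha).trans_le (measure_mono fun y hy => ?_)
      simp only [Set.mem_Ioi] at hy
      rw [Function.mem_support]
      have : max (y - b) 0 < max (y - a) 0 := by
        rw [max_eq_left (by linarith : (0 : ℝ) ≤ y - a)]
        exact max_lt (by linarith) (by linarith)
      linarith
    · have : max (y - b) 0 ≤ max (y - a) 0 := max_le_max (by linarith) le_rfl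
      simpa using this
  rw [integral_sub (integrable_posPart_fisher D hN a) (integrable_posPart_fisher D hN b)] at h0
  simpa using h0

/-- For `D ≥ 1` and `N ≥ 3`, the mean of the Fisher distribution is finite and positive. -/
lemma integral_fisher_pos {D N : ℕ} (hD : 1 ≤ D) (hN : 3 ≤ N) : 0 < ∫ y, y ∂fisher D N := by
  refine (integral_pos_iff_support_of_nonneg_ae (fisher_ae_nonneg D N)
    (integrable_id_fisher D hN)).2 ?_
  refine (fisher_Ioi_pos hD (by lia) le_rfl).trans_le (measure_mono fun y hy => ?_)
  exact (Set.mem_Ioi.1 hy).ne'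

/-- The equation defining `EFish` has exactly one nonnegative solution. -/
theorem existsUnique_Fish_eq {D N : ℕ} (hD : 1 ≤ D) (hN : 3 ≤ N) {q : ℝ} (hq : 0 < q)
    (hq1 : q ≤ 1) : ∃! x : ℝ, 0 ≤ x ∧ Fish D N x = q := by
  have hE := integral_fisher_pos hD hN
  have hanti : StrictAntiOn (Fish D N) (Set.Ici 0) := fun a ha b hb hab =>
    div_lt_div_of_pos_right (strictAntiOn_posPart_fisher hD hN ha hb hab) hE
  have hF0 : Fish D N 0 = 1 := by
    rw [Fish, div_eq_one_iff_eq hE.ne']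
    refine integral_congr_ae ?_
    filter_upwards [fisher_ae_nonneg D N] with y hy
    simpa using hy
  have hcont : Continuous (Fish D N) := by
    refine Continuous.div_const (LipschitzWith.continuous (K := 1) ?_) _
    refine LipschitzWith.of_dist_le_mul fun a b => ?_
    rw [Real.dist_eq, ← integral_sub (integrable_posPart_fisher D hN a)
      (integrable_posPart_fisher D hN b), ← Real.norm_eq_abs]
    refine (norm_integral_le_of_norm_le_const (C := dist a b)
      (Filter.Eventually.of_forall fun y => ?_)).trans (by simp)
    refine (abs_max_sub_max_le_abs _ _ _).trans ?_
    rw [Real.dist_eq, abs_sub_comm a b]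
    simp
  have hlim : Filter.Tendsto (Fish D N) Filter.atTop (nhds 0) := by
    have h : Filter.Tendsto (fun x => ∫ y, max (y - x) 0 ∂fisher D N) Filter.atTop
        (nhds (∫ _, (0 : ℝ) ∂fisher D N)) := by
      refine tendsto_integral_filter_of_dominated_convergence (fun y => |y|)
        (Filter.Eventually.of_forall fun x => (integrable_posPart_fisher D hN x).1) ?_
        (integrable_id_fisher D hN).abs ?_
      · filter_upwards [Filter.eventually_ge_atTop (0 : ℝ)] with x hx
        refine Filter.Eventually.of_forall fun y => ?_
        rw [Real.norm_of_nonneg (le_max_right _ _)]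
        exact max_le (by have := le_abs_self y; linarith) (abs_nonneg y)
      · refine Filter.Eventually.of_forall fun y => ?_
        refine tendsto_const_nhds.congr' ?_
        filter_upwards [Filter.eventually_ge_atTop y] with x hx
        rw [max_eq_right (by linarith)]
    have h2 := h.div_const (∫ y, y ∂fisher D N)
    rwa [integral_zero, zero_div] at h2
  obtain ⟨b, hb0, hb⟩ := ((Filter.eventually_ge_atTop (0 : ℝ)).and
    (hlim.eventually (gt_mem_nhds hq))).exists
  obtain ⟨x, hx, hxq⟩ := intermediate_value_Icc' hb0 hcont.continuousOn
    (show q ∈ Set.Icc (Fish D N b) (Fish D N 0) from ⟨hb.le, hF0 ▸ hq1⟩)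
  refine ⟨x, ⟨hx.1, hxq⟩, fun y hy => hanti.injOn hy.1 hx.1 (hy.2.trans hxq.symm)⟩

/-- `EFish[D, N, q]` is the solution of `Fish[D, N, x] = q`. -/
theorem EFish_spec {D N : ℕ} (hD : 1 ≤ D) (hN : 3 ≤ N) {q : ℝ} (hq : 0 < q) (hq1 : q ≤ 1) :
    0 ≤ EFish D N q ∧ Fish D N (EFish D N q) = q := by
  obtain ⟨x, hx, hu⟩ := existsUnique_Fish_eq hD hN hq hq1
  have hset : {x : ℝ | 0 ≤ x ∧ Fish D N x = q} = {x} :=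
    Set.eq_singleton_iff_unique_mem.2 ⟨hx, hu⟩
  rw [EFish, if_neg hq1.not_gt, hset, csInf_singleton]
  exact hx

end GaussianModelSelection

/-! `Fish` decreases in `x`, so an upper bound `x` for `EFish` follows once `Fish D N x ≤ exp (-l)`,
which comes from a Chernoff argument. With `F = (U/D)/(V/N)`, write `(F - x)₊ = (N/V) (U/D - xV/N)₊`
and bound `y₊` by `exp (a y) / (e a)`. Independence separates `U` from `V`. The weight `V⁻¹`,
normalised by its mean, turns χ² with `N` degrees of freedom into χ² with `M = N - 2`, and `𝔼[F] = N
𝔼[V⁻¹]` cancels the normalisation (`Fish_le_chernoff`).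

At `x = (N/M)(1+u)²` the optimal `a` gives an explicit rate (`Fish_le_exp_neg_fisherRate`), which is
at least `(M/4) log (1 + 2Du²/(N+2D))` (`log_one_add_le_fisherRate`). The `u` of the theorem makes
the argument of this logarithm `1 + t exp t` with `t = 4Δ'/N`. Since `1 + t exp t ≥ exp t`, the rate
is at least `MΔ'/N ≥ (1 - 5/M)Δ' ≥ l`. -/

namespace GaussianModelSelection

/-! ### Gaussian measures under dilation -/

/-- The standard Gaussian measure on `Fin d → ℝ` has the product density. -/
lemma pi_gaussianReal_eq_withDensity (d : ℕ) :
    (Measure.pi fun _ : Fin d => gaussianReal 0 1) =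
      volume.withDensity fun z : Fin d → ℝ => ENNReal.ofReal (∏ i, gaussianPDFReal 0 1 (z i)) := by
  refine Measure.pi_eq fun s hs => ?_
  rw [withDensity_apply _ (MeasurableSet.univ_pi hs), volume_pi, Measure.restrict_pi_pi,
    ← ofReal_integral_eq_lintegral_ofReal
      (Integrable.fintype_prod fun i => (integrable_gaussianPDFReal 0 1).restrict)
      (Filter.Eventually.of_forall fun z =>
        Finset.prod_nonneg fun i _ => gaussianPDFReal_nonneg 0 1 (z i)),
    integral_fintype_prod_eq_prod (fun _ => gaussianPDFReal 0 1),
    ENNReal.ofReal_prod_of_nonneg fun i _ =>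
      integral_nonneg fun x => gaussianPDFReal_nonneg 0 1 x]
  exact Finset.prod_congr rfl fun i _ =>
    (gaussianReal_apply_eq_integral 0 one_ne_zero (s i)).symm

lemma prod_gaussianPDFReal_smul {d : ℕ} (ρ : ℝ) (z : Fin d → ℝ) :
    ∏ i, gaussianPDFReal 0 1 ((ρ • z) i) =
      (∏ i, gaussianPDFReal 0 1 (z i)) * Real.exp (-((ρ ^ 2 - 1) / 2 * ∑ i, z i ^ 2)) := by
  rw [Finset.mul_sum, ← Finset.sum_neg_distrib, Real.exp_sum, ← Finset.prod_mul_distrib]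
  refine Finset.prod_congr rfl fun i _ => ?_
  simp only [gaussianPDFReal, Pi.smul_apply, smul_eq_mul, sub_zero, NNReal.coe_one]
  rw [mul_assoc _ (Real.exp _), ← Real.exp_add]
  ring_nf

lemma measurable_prod_gaussianPDFReal (d : ℕ) :
    Measurable fun z : Fin d → ℝ => ∏ i, gaussianPDFReal 0 1 (z i) :=
  Finset.measurable_prod _ fun i _ => (measurable_gaussianPDFReal 0 1).comp (measurable_pi_apply i)

lemma integral_pi_gaussianReal {d : ℕ} (f : (Fin d → ℝ) → ℝ) :
    ∫ z, f z ∂(Measure.pi fun _ : Fin d => gaussianReal 0 1) =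
      ∫ z, (∏ i, gaussianPDFReal 0 1 (z i)) * f z := by
  rw [pi_gaussianReal_eq_withDensity, integral_withDensity_eq_integral_toReal_smul
    (measurable_prod_gaussianPDFReal d).ennreal_ofReal (by simp)]
  refine integral_congr_ae (Filter.Eventually.of_forall fun z => ?_)
  simp only [smul_eq_mul]
  rw [ENNReal.toReal_ofReal (Finset.prod_nonneg fun i _ => gaussianPDFReal_nonneg 0 1 (z i))]

lemma integrable_pi_gaussianReal_iff {d : ℕ} (f : (Fin d → ℝ) → ℝ) :
    Integrable f (Measure.pi fun _ : Fin d => gaussianReal 0 1) ↔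
      Integrable fun z => (∏ i, gaussianPDFReal 0 1 (z i)) * f z := by
  rw [pi_gaussianReal_eq_withDensity, integrable_withDensity_iff_integrable_smul'
    (measurable_prod_gaussianPDFReal d).ennreal_ofReal (by simp)]
  refine integrable_congr (Filter.Eventually.of_forall fun z => ?_)
  simp only [smul_eq_mul]
  rw [ENNReal.toReal_ofReal (Finset.prod_nonneg fun i _ => gaussianPDFReal_nonneg 0 1 (z i))]

/-- Exponential tilting of the Gaussian measure by the squared norm is a dilation. -/
lemma integral_pi_gaussianReal_comp_smul {d : ℕ} (f : (Fin d → ℝ) → ℝ) {ρ : ℝ} (hρ : 0 < ρ) :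
    ∫ z, Real.exp (-((ρ ^ 2 - 1) / 2 * ∑ i, z i ^ 2)) * f (ρ • z)
        ∂(Measure.pi fun _ : Fin d => gaussianReal 0 1) =
      (ρ ^ d)⁻¹ * ∫ z, f z ∂(Measure.pi fun _ : Fin d => gaussianReal 0 1) := by
  have h := Measure.integral_comp_smul_of_nonneg (volume : Measure (Fin d → ℝ))
    (fun z => (∏ i, gaussianPDFReal 0 1 (z i)) * f z) ρ (hR := hρ.le)
  simp only [prod_gaussianPDFReal_smul, Module.finrank_fin_fun, smul_eq_mul] at h
  rw [integral_pi_gaussianReal, integral_pi_gaussianReal f, ← h]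
  simp only [mul_assoc]

lemma integrable_pi_gaussianReal_comp_smul {d : ℕ} {f : (Fin d → ℝ) → ℝ} {ρ : ℝ} (hρ : 0 < ρ)
    (hf : Integrable f (Measure.pi fun _ : Fin d => gaussianReal 0 1)) :
    Integrable (fun z => Real.exp (-((ρ ^ 2 - 1) / 2 * ∑ i, z i ^ 2)) * f (ρ • z))
      (Measure.pi fun _ : Fin d => gaussianReal 0 1) := by
  rw [integrable_pi_gaussianReal_iff] at hf ⊢
  have h := (integrable_comp_smul_iff (volume : Measure (Fin d → ℝ))
    (fun z => (∏ i, gaussianPDFReal 0 1 (z i)) * f z) hρ.ne').2 hf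
  simpa only [prod_gaussianPDFReal_smul, mul_assoc] using h

lemma sum_smul_sq {d : ℕ} (ρ : ℝ) (z : Fin d → ℝ) :
    ∑ i, (ρ • z) i ^ 2 = ρ ^ 2 * ∑ i, z i ^ 2 := by
  rw [Finset.mul_sum]
  exact Finset.sum_congr rfl fun i _ => by simp only [Pi.smul_apply, smul_eq_mul]; ring

/-! ### Laplace transforms of χ² and of its inverse-biased version -/

lemma integral_chiSquared {d : ℕ} {f : ℝ → ℝ} (hf : Measurable f) :
    ∫ u, f u ∂chiSquared d =
      ∫ z, f (∑ i, z i ^ 2) ∂(Measure.pi fun _ : Fin d => gaussianReal 0 1) :=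
  integral_map (measurable_sumSq d).aemeasurable hf.aestronglyMeasurable

lemma integrable_chiSquared_iff {d : ℕ} {f : ℝ → ℝ} (hf : Measurable f) :
    Integrable f (chiSquared d) ↔
      Integrable (fun z => f (∑ i, z i ^ 2)) (Measure.pi fun _ : Fin d => gaussianReal 0 1) :=
  integrable_map_measure hf.aestronglyMeasurable (measurable_sumSq d).aemeasurable

lemma ae_nonneg_chiSquared (d : ℕ) : ∀ᵐ u ∂chiSquared d, 0 ≤ u := by
  rw [chiSquared, ae_map_iff (measurable_sumSq d).aemeasurable measurableSet_Ici]
  exact Filter.Eventually.of_forall fun z => by positivity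

lemma integral_id_chiSquared (d : ℕ) : ∫ u, u ∂chiSquared d = d := by
  have h : ∫ x, x ^ 2 ∂gaussianReal 0 1 = 1 := by
    have := variance_of_integral_eq_zero (X := id) (μ := gaussianReal 0 1) (by fun_prop)
      (by simp)
    rw [variance_id_gaussianReal] at this
    simpa using this.symm
  have hi : Integrable (fun x : ℝ => x ^ 2) (gaussianReal 0 1) :=
    (memLp_id_gaussianReal (μ := 0) (v := 1) 2).integrable_sq
  rw [integral_chiSquared measurable_id']
  rw [integral_finsetSum _ fun i _ =>
    integrable_comp_eval (μ := fun _ : Fin d => gaussianReal 0 1) (i := i) hi]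
  simp [integral_comp_eval (μ := fun _ : Fin d => gaussianReal 0 1)
    (f := fun x : ℝ => x ^ 2) hi.aestronglyMeasurable, h]

lemma integrable_exp_mul_chiSquared (d : ℕ) {θ : ℝ} (hθ : 2 * θ < 1) :
    Integrable (fun u => Real.exp (θ * u)) (chiSquared d) := by
  have h0 : 0 < 1 - 2 * θ := by linarith
  rw [integrable_chiSquared_iff (by fun_prop)]
  have h := integrable_pi_gaussianReal_comp_smul (d := d) (Real.sqrt_pos.2 h0)
    (integrable_const (1 : ℝ))
  refine h.congr (Filter.Eventually.of_forall fun z => ?_)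
  simp only [mul_one, Real.sq_sqrt h0.le]
  ring_nf

/-- The moment generating function of the `χ²` distribution. -/
lemma integral_exp_mul_chiSquared (d : ℕ) {θ : ℝ} (hθ : 2 * θ < 1) :
    ∫ u, Real.exp (θ * u) ∂chiSquared d = (√(1 - 2 * θ) ^ d)⁻¹ := by
  have h0 : 0 < 1 - 2 * θ := by linarith
  rw [integral_chiSquared (by fun_prop)]
  have h := integral_pi_gaussianReal_comp_smul (d := d) (fun _ => 1) (Real.sqrt_pos.2 h0)
  rw [integral_const, probReal_univ, one_smul, mul_one] at h
  rw [← h]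
  refine integral_congr_ae (Filter.Eventually.of_forall fun z => ?_)
  simp only [mul_one, Real.sq_sqrt h0.le]
  ring_nf

lemma integrable_inv_mul_exp_chiSquared {d : ℕ} (hd : 3 ≤ d) {s : ℝ} (hs : 0 < 1 + 2 * s) :
    Integrable (fun v => v⁻¹ * Real.exp (-(s * v))) (chiSquared d) := by
  rw [integrable_chiSquared_iff (by fun_prop)]
  have h := (integrable_pi_gaussianReal_comp_smul (d := d) (Real.sqrt_pos.2 hs)
    ((integrable_chiSquared_iff measurable_inv).1 (integrable_inv_chiSquared hd))).const_mul
    (1 + 2 * s)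
  refine h.congr (Filter.Eventually.of_forall fun z => ?_)
  simp only [sum_smul_sq, Real.sq_sqrt hs.le, mul_inv]
  rw [show (1 + 2 * s - 1) / 2 = s by ring]
  field_simp

/-- The Laplace transform of the inverse-biased `χ²` distribution with `d` degrees of freedom is
that of the `χ²` distribution with `d - 2` degrees of freedom. -/
lemma integral_inv_mul_exp_chiSquared {d : ℕ} (hd : 2 ≤ d) {s : ℝ} (hs : 0 < 1 + 2 * s) :
    ∫ v, v⁻¹ * Real.exp (-(s * v)) ∂chiSquared d =
      (√(1 + 2 * s) ^ (d - 2))⁻¹ * ∫ v, v⁻¹ ∂chiSquared d := by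
  rw [integral_chiSquared (by fun_prop), integral_chiSquared measurable_inv]
  have hρ := Real.sqrt_pos.2 hs
  have h := integral_pi_gaussianReal_comp_smul (d := d) (fun z => (∑ i, z i ^ 2)⁻¹) hρ
  -- The dilation divides `v⁻¹` by `1 + 2s`; compensating for this cancels two of the `d` powers of
  -- the square root.
  have hpow : (√(1 + 2 * s) ^ (d - 2))⁻¹ = (1 + 2 * s) * (√(1 + 2 * s) ^ d)⁻¹ := by
    rw [← Nat.sub_add_cancel hd, pow_add, Real.sq_sqrt hs.le, Nat.add_sub_cancel]
    field_simp
  rw [hpow, mul_assoc, ← h, ← integral_const_mul]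
  refine integral_congr_ae (Filter.Eventually.of_forall fun z => ?_)
  simp only [sum_smul_sq, Real.sq_sqrt hs.le, mul_inv]
  rw [show (1 + 2 * s - 1) / 2 = s by ring]
  linear_combination (-((∑ i, z i ^ 2)⁻¹ * Real.exp (-(s * ∑ i, z i ^ 2)))) *
    mul_inv_cancel₀ hs.ne'

/-! ### Chernoff's bound for the Fisher distribution -/

/-- The inverse moment is left unevaluated, because it cancels in `Fish`. -/
lemma integral_id_fisher {D : ℕ} (hD : 1 ≤ D) (N : ℕ) :
    ∫ y, y ∂fisher D N = N * ∫ v, v⁻¹ ∂chiSquared N := by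
  have hD0 : (D : ℝ) ≠ 0 := by positivity
  rw [fisher, integral_map (by fun_prop) (by fun_prop)]
  have h := integral_prod_mul (μ := chiSquared D) (ν := chiSquared N) (fun u : ℝ => u)
    (fun v : ℝ => v⁻¹)
  rw [integral_id_chiSquared] at h
  calc ∫ p : ℝ × ℝ, p.1 / D / (p.2 / N) ∂(chiSquared D).prod (chiSquared N)
      = ∫ p : ℝ × ℝ, (N / D : ℝ) * (p.1 * p.2⁻¹) ∂(chiSquared D).prod (chiSquared N) := by
        refine integral_congr_ae (Filter.Eventually.of_forall fun p => ?_)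
        simp only [div_eq_mul_inv, mul_inv, inv_inv]
        ring
    _ = N * ∫ v, v⁻¹ ∂chiSquared N := by
        rw [integral_const_mul, h]
        field_simp

/-- This is `1 + t ≤ exp t` at `t = a y - 1`; the constant is sharp, with equality at `y = 1 / a`.
-/
lemma max_zero_le_exp {a : ℝ} (ha : 0 < a) (y : ℝ) :
    max y 0 ≤ (Real.exp 1 * a)⁻¹ * Real.exp (a * y) := by
  refine max_le ?_ (by positivity)
  have h := Real.add_one_le_exp (a * y - 1)
  rw [Real.exp_sub] at h
  rw [mul_inv, mul_right_comm, inv_mul_eq_div, ← div_eq_mul_inv, le_div_iff₀ ha]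
  linarith

/-- Chernoff's bound for `Fish`. -/
lemma Fish_le_chernoff {D N : ℕ} (hD : 1 ≤ D) (hN : 3 ≤ N) {x a : ℝ} (hx : 0 ≤ x) (ha : 0 < a)
    (haD : 2 * (a / D) < 1) :
    Fish D N x ≤ (Real.exp 1 * a)⁻¹ * (√(1 - 2 * (a / D)) ^ D)⁻¹ *
      (√(1 + 2 * (a * x / N)) ^ (N - 2))⁻¹ := by
  have hs : 0 < 1 + 2 * (a * x / N) := by positivity
  have hN0 : (0 : ℝ) < N := by positivity
  have hE := integral_fisher_pos hD hN
  rw [Fish, div_le_iff₀ hE, integral_id_fisher hD, fisher, integral_map (by fun_prop)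
    (Measurable.aestronglyMeasurable (by fun_prop))]
  have hint := (((integrable_exp_mul_chiSquared D haD).mul_prod
    (integrable_inv_mul_exp_chiSquared hN hs)).const_mul (N * (Real.exp 1 * a)⁻¹))
  refine (integral_mono_ae ?_ hint ?_).trans_eq ?_
  · exact (integrable_map_measure (Measurable.aestronglyMeasurable (by fun_prop))
      (by fun_prop)).1 (integrable_posPart_fisher D hN x)
  · have h2 := (Measure.quasiMeasurePreserving_snd
      (μ := chiSquared D) (ν := chiSquared N)).ae (ae_nonneg_chiSquared N)
    filter_upwards [h2] with p hp
    -- At `V = 0` division by zero makes the ratio and the bound vanish, and `x ≥ 0` makes the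
    -- positive part vanish too.
    rcases hp.eq_or_lt with h0 | h0
    · rw [← h0]
      simpa using hx
    · have h := mul_le_mul_of_nonneg_left (max_zero_le_exp ha (p.1 / D - x * p.2 / N))
        (div_pos hN0 h0).le
      rw [mul_max_of_nonneg _ _ (div_pos hN0 h0).le, mul_zero] at h
      convert h using 1
      · congr 1
        field_simp
      · rw [show a * (p.1 / D - x * p.2 / N) = a / D * p.1 + -(a * x / N * p.2) by ring,
          Real.exp_add]
        ring
  · rw [integral_const_mul, integral_prod_mul (fun u => Real.exp (a / D * u))
      (fun v => v⁻¹ * Real.exp (-(a * x / N * v))), integral_exp_mul_chiSquared D haD,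
      integral_inv_mul_exp_chiSquared (by lia) hs]
    ring

lemma EFish_le_of_Fish_le {D N : ℕ} (hD : 1 ≤ D) (hN : 3 ≤ N) {q x : ℝ} (hq : 0 < q)
    (hq1 : q ≤ 1) (hx : 0 ≤ x) (h : Fish D N x ≤ q) : EFish D N q ≤ x := by
  obtain ⟨h0, hF⟩ := EFish_spec hD hN hq hq1
  by_contra! hlt
  have := div_lt_div_of_pos_right (strictAntiOn_posPart_fisher hD hN hx h0 hlt)
    (integral_fisher_pos hD hN)
  exact (h.trans_eq hF.symm).not_gt this

/-! ### The rate function and the bound on `EFish` -/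

/-- A lower bound for the Cramér transform of the Fisher distribution at `(1 + u) ^ 2`. -/
lemma log_one_add_le_fisherRate {D M u : ℝ} (hD : 0 < D) (hM : 0 < M) (hu : 0 ≤ u) :
    M / 4 * Real.log ((M + 2 + 2 * D + 2 * D * u ^ 2) / (M + 2 + 2 * D)) ≤
      (D + M) / 2 * Real.log ((M + (1 + u) ^ 2 * D) / (M + D)) - D * Real.log (1 + u) := by
  -- Up to an additive constant, `f` is the difference of the two sides. They agree at `u = 0`, so
  -- monotonicity suffices.
  let f : ℝ → ℝ := fun u => (D + M) / 2 * Real.log (M + (1 + u) ^ 2 * D) - D * Real.log (1 + u)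
    - M / 4 * Real.log (M + 2 + 2 * D + 2 * D * u ^ 2)
  have hderiv : ∀ v, 0 ≤ v → HasDerivAt f
      ((D + M) / 2 * (2 * (1 + v) * D / (M + (1 + v) ^ 2 * D)) - D * (1 / (1 + v))
        - M / 4 * (4 * D * v / (M + 2 + 2 * D + 2 * D * v ^ 2))) v := by
    intro v hv
    have h1 : HasDerivAt (fun v : ℝ => 1 + v) 1 v := (hasDerivAt_id v).const_add 1
    have hA : HasDerivAt (fun v : ℝ => M + (1 + v) ^ 2 * D) (2 * (1 + v) * D) v := by
      exact (((h1.pow 2).mul_const D).const_add M).congr_deriv (by norm_num)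
    have hB : HasDerivAt (fun v : ℝ => M + 2 + 2 * D + 2 * D * v ^ 2) (4 * D * v) v := by
      exact (((hasDerivAt_pow 2 v).const_mul (2 * D)).const_add (M + 2 + 2 * D)).congr_deriv
        (by norm_num; ring)
    exact ((hA.log (by positivity)).const_mul _ |>.sub ((h1.log (by positivity)).const_mul _)).sub
      ((hB.log (by positivity)).const_mul _)
  have hmono : MonotoneOn f (Set.Ici 0) := by
    refine monotoneOn_of_deriv_nonneg (convex_Ici 0)
      (fun v hv => (hderiv v hv).continuousAt.continuousWithinAt)
      (fun v hv => (hderiv v (interior_subset hv)).differentiableAt.differentiableWithinAt)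
      fun v hv => ?_
    have hv : 0 ≤ v := interior_subset hv
    rw [(hderiv v hv).deriv]
    have hA : 0 < M + (1 + v) ^ 2 * D := by positivity
    have hB : 0 < M + 2 + 2 * D + 2 * D * v ^ 2 := by positivity
    have h1 : 0 < 1 + v := by positivity
    -- The only possibly negative term of the numerator, `D (v² - v) ≥ -D/4`, is absorbed by `3D`.
    have key : (D + M) / 2 * (2 * (1 + v) * D / (M + (1 + v) ^ 2 * D)) - D * (1 / (1 + v))
        - M / 4 * (4 * D * v / (M + 2 + 2 * D + 2 * D * v ^ 2)) =
        D * M * v * (M + 3 * D + D * (v ^ 2 - v) + D * v ^ 3 + 2 * (2 + v)) /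
          ((1 + v) * (M + (1 + v) ^ 2 * D) * (M + 2 + 2 * D + 2 * D * v ^ 2)) := by
      field_simp
      ring
    rw [key]
    have : 0 ≤ 3 * D + D * (v ^ 2 - v) := by nlinarith [mul_nonneg hD.le (sq_nonneg (v - 1 / 2))]
    have h3 : 0 ≤ M + 3 * D + D * (v ^ 2 - v) + D * v ^ 3 + 2 * (2 + v) := by
      have : 0 ≤ D * v ^ 3 := by positivity
      linarith
    positivity
  have h := hmono Set.self_mem_Ici (Set.mem_Ici.2 hu) hu
  simp only [f] at h
  norm_num at h
  rw [Real.log_div (by positivity) (by positivity), Real.log_div (by positivity) (by positivity)]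
  rw [add_comm D M] at h ⊢
  linarith

lemma inv_sqrt_pow_eq_exp {a : ℝ} (ha : 0 < a) (k : ℕ) :
    (√a ^ k)⁻¹ = Real.exp (-(k / 2 * Real.log a)) := by
  rw [Real.sqrt_eq_rpow, ← Real.rpow_natCast, ← Real.rpow_mul ha.le, Real.rpow_def_of_pos ha,
    ← Real.exp_neg]
  ring_nf

/-- Chernoff's bound for `Fish`, at the optimal value of the parameter. -/
lemma Fish_le_exp_neg_fisherRate {D N : ℕ} (hD : 2 ≤ D) (hN : 8 ≤ N) {M u : ℝ}
    (hM : M = N - 2) (hu : 0 < u) (hu2 : 2 * (1 / D + 1 / M) ≤ u ^ 2) :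
    Fish D N (N / M * (1 + u) ^ 2) ≤
      Real.exp (-((D + M) / 2 * Real.log ((M + (1 + u) ^ 2 * D) / (M + D))
        - D * Real.log (1 + u))) := by
  have hD2 : (2 : ℝ) ≤ D := by exact_mod_cast hD
  have hN8 : (8 : ℝ) ≤ N := by exact_mod_cast hN
  have hM6 : 6 ≤ M := by linarith
  have hD0 : (0 : ℝ) < D := by linarith
  have hM0 : 0 < M := by linarith
  have hN0 : (0 : ℝ) < N := by linarith
  have hMN : ((N - 2 : ℕ) : ℝ) = M := by
    rw [Nat.cast_sub (by lia), hM]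
    norm_num
  generalize hr : (1 + u) ^ 2 = r at *
  have hr1 : 1 + u ^ 2 < r := by nlinarith
  have hr0 : 0 < r := by nlinarith
  have hrm : 0 < r - 1 := by nlinarith
  -- The minimiser of the product of the two Laplace factors, the prefactor `1 / (e a)` being left
  -- aside.
  set a : ℝ := D * M * (r - 1) / (2 * r * (D + M)) with ha
  have ha0 : 0 < a := by positivity
  have e1 : 1 - 2 * (a / D) = (M + r * D) / (M + D) / r := by
    rw [ha]
    field_simp
    ring
  have e2 : 1 + 2 * (a * (N / M * r) / N) = (M + r * D) / (M + D) := by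
    rw [ha]
    field_simp
    ring
  have hA : 0 < (M + r * D) / (M + D) := by positivity
  have h := Fish_le_chernoff (D := D) (N := N) (by lia) (by lia) (x := N / M * r) (by positivity) ha0
    (by have : 0 < 1 - 2 * (a / D) := by rw [e1]; positivity
        linarith)
  rw [e1, e2, inv_sqrt_pow_eq_exp (by positivity), inv_sqrt_pow_eq_exp hA, mul_assoc,
    ← Real.exp_add, hMN, Real.log_div hA.ne' hr0.ne'] at h
  have hlr : Real.log r = 2 * Real.log (1 + u) := by
    rw [← hr, Real.log_pow]
    norm_num
  -- With `p = 1/D + 1/M ≤ 1/2 + 1/6 = 2/3` and `r ≥ 1 + 2p`, one gets `a = (r-1)/(2rp) ≥ 1/(1+2p) ≥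
  -- 3/7 > 1/e`.
  have ha1 : (Real.exp 1 * a)⁻¹ ≤ 1 := by
    refine inv_le_one_of_one_le₀ ?_
    have hp : 1 / (D : ℝ) + 1 / M = (D + M) / (D * M) := by
      field_simp
      ring
    have hple : (D + M) / (D * M) ≤ 2 / 3 := by
      rw [div_le_div_iff₀ (by positivity) (by positivity)]
      nlinarith [mul_nonneg (sub_nonneg.2 hD2) (sub_nonneg.2 hM6)]
    rw [hp] at hu2
    have hp0 : 0 < (D + M) / (D * M) := by positivity
    have hae : a = (r - 1) / (2 * r * ((D + M) / (D * M))) := by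
      rw [ha]
      field_simp
    generalize (D + M) / (D * M) = p at *
    have : 3 / 7 * (2 * r * p) ≤ r - 1 := by nlinarith
    have : 3 / 7 ≤ a := by rwa [hae, le_div_iff₀ (by positivity)]
    nlinarith [Real.exp_one_gt_d9]
  refine (h.trans (mul_le_of_le_one_left (Real.exp_pos _).le ha1)).trans_eq ?_
  rw [hlr]
  ring_nf

/-- The term `log 5 ≥ 1` ensures `δ ≥ 1`, which makes `u` large enough for the Chernoff prefactor to
be at most `1`. -/
lemma EFish_exp_neg_le {D N : ℕ} (hD : 2 ≤ D) (hN : 8 ≤ N) {l δ : ℝ} (hl : 0 ≤ l)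
    (hδ : δ = (l + Real.log 5 + 1 / ((N : ℝ) - 2)) / (1 - 5 / ((N : ℝ) - 2))) :
    EFish D N (Real.exp (-l)) ≤ N / ((N : ℝ) - 2) *
      (1 + Real.exp (2 * δ / N) * √((1 + 2 * D / N) * (2 * δ / D))) ^ 2 := by
  have hD2 : (2 : ℝ) ≤ D := by exact_mod_cast hD
  have hN8 : (8 : ℝ) ≤ N := by exact_mod_cast hN
  have hD0 : (0 : ℝ) < D := by linarith
  have hN0 : (0 : ℝ) < N := by linarith
  obtain ⟨M, hM⟩ : ∃ M : ℝ, M = N - 2 := ⟨_, rfl⟩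
  rw [← hM] at hδ ⊢
  have hM6 : 6 ≤ M := by linarith
  have hM0 : 0 < M := by linarith
  have hlog5 : 1 ≤ Real.log 5 := by
    rw [Real.le_log_iff_exp_le (by norm_num)]
    linarith [Real.exp_one_lt_d9]
  have h5 : 0 < 1 - 5 / M := by
    rw [sub_pos, div_lt_one hM0]
    linarith
  have hM1 : 0 < 1 / M := by positivity
  have hδl : (1 - 5 / M) * δ = l + Real.log 5 + 1 / M := by
    rw [hδ, mul_comm, div_mul_cancel₀ _ h5.ne']
  have hδ1 : 1 ≤ δ := by
    have : 0 < 5 / M := by positivity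
    by_contra! hc
    nlinarith
  have hδ0 : 0 < δ := by linarith
  set w : ℝ := (1 + 2 * D / N) * (2 * δ / D) with hw
  have hw0 : 0 < w := by positivity
  set u : ℝ := Real.exp (2 * δ / N) * √w with hu
  have hu0 : 0 < u := mul_pos (Real.exp_pos _) (Real.sqrt_pos.2 hw0)
  have husq : u ^ 2 = Real.exp (4 * δ / N) * w := by
    rw [hu, mul_pow, Real.sq_sqrt hw0.le, ← Real.exp_nat_mul]
    congr 2
    push_cast
    ring
  -- Here `u² ≥ w = 2 (1/D + 2/N) δ`, with `δ ≥ 1` and `2/N ≥ 1/M`.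
  have hu2 : 2 * (1 / D + 1 / M) ≤ u ^ 2 := by
    have h1 : 1 ≤ Real.exp (4 * δ / N) := Real.one_le_exp (by positivity)
    have h2 : w = 2 * (1 / D + 2 / N) * δ := by
      rw [hw]
      field_simp
    have h3 : 1 / M ≤ 2 / (N : ℝ) := by
      rw [div_le_div_iff₀ hM0 hN0]
      linarith
    have h4 : 0 < 1 / (D : ℝ) := by positivity
    rw [husq]
    nlinarith
  refine EFish_le_of_Fish_le (by lia) (by lia) (Real.exp_pos _) (Real.exp_le_one_iff.2 (by linarith))
    (by positivity) ((Fish_le_exp_neg_fisherRate hD hN hM hu0 hu2).trans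
      (Real.exp_le_exp.2 (neg_le_neg ?_)))
  refine le_trans ?_ (log_one_add_le_fisherRate hD0 hM0 hu0.le)
  have hN2 : M + 2 = N := by linarith
  rw [hN2]
  have hexp : Real.exp (4 * δ / N) ≤ (N + 2 * D + 2 * D * u ^ 2) / (N + 2 * D) := by
    have h1 : (N + 2 * D + 2 * D * u ^ 2) / (N + 2 * D) =
        1 + 4 * δ / N * Real.exp (4 * δ / N) := by
      rw [husq, hw]
      field_simp
      ring
    -- Multiplying `1 - t ≤ exp (-t)` by `exp t` yields `exp t ≤ 1 + t exp t`; this is why `u`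
    -- carries the factor `exp (2δ/N)`.
    have h2 := Real.add_one_le_exp (-(4 * δ / N))
    have h3 := mul_le_mul_of_nonneg_right h2 (Real.exp_pos (4 * δ / N)).le
    rw [← Real.exp_add, neg_add_cancel, Real.exp_zero] at h3
    rw [h1]
    linarith
  have hlog := (Real.le_log_iff_exp_le (by positivity)).2 hexp
  -- This is `1 - 5/M ≤ M/N`, since `(1 - 5/M)(M + 2) = M - 3 - 10/M ≤ M`.
  have h1 : (1 - 5 / M) * δ ≤ M / 4 * (4 * δ / N) := by
    rw [show M / 4 * (4 * δ / N) = M / N * δ by ring]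
    refine mul_le_mul_of_nonneg_right ?_ hδ0.le
    rw [le_div_iff₀ hN0, ← hN2]
    have : (1 - 5 / M) * (M + 2) = M - 3 - 10 / M := by
      field_simp
      ring
    have : 0 < 10 / M := by positivity
    linarith
  have h2 := mul_le_mul_of_nonneg_left hlog (show 0 ≤ M / 4 by positivity)
  linarith

end GaussianModelSelection

theorem proposition6 {n : ℕ} {M : Type*}
    (S : M → Submodule ℝ (EuclideanSpace ℝ (Fin n)))
    (K₁ K₂ : ℝ) (hK₁ : 1 < K₁) (hK₂ : K₁ ≤ K₂)
    (L : M → ℝ) (hL : ∀ m, 0 ≤ L m)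
    (m : M)
    (hD : 1 ≤ GaussianModelSelection.modelDim (S m))
    (hN : 9 ≤ GaussianModelSelection.modelCodim (S m))
    (D N Δ' : ℝ)
    (hDdef : D = (GaussianModelSelection.modelDim (S m) : ℝ) + 1)
    (hNdef : N = (GaussianModelSelection.modelCodim (S m) : ℝ) - 1)
    (hΔ' : Δ' = (L m + Real.log 5 + 1 / (N - 2)) / (1 - 5 / (N - 2))) :
    GaussianModelSelection.penKullback S K₁ K₂ L m ≤
      K₁ * K₂ / (K₂ - 1) * ((N + 1) / (N - 2)) *
        (1 + Real.exp (2 * Δ' / N) * Real.sqrt ((1 + 2 * D / N) * (2 * Δ' / D))) ^ 2 * D := by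
  rw [GaussianModelSelection.penKullback, GaussianModelSelection.kullbackPenalty]
  generalize GaussianModelSelection.modelDim (S m) = d at *
  generalize GaussianModelSelection.modelCodim (S m) = c at *
  have hc9 : (9 : ℝ) ≤ c := by exact_mod_cast hN
  have hd1 : (1 : ℝ) ≤ d := by exact_mod_cast hD
  have hD' : ((d + 1 : ℕ) : ℝ) = D := by rw [hDdef]; push_cast; ring
  have hN' : ((c - 1 : ℕ) : ℝ) = N := by
    rw [hNdef, Nat.cast_sub (by lia)]
    norm_num
  have h := GaussianModelSelection.EFish_exp_neg_le (D := d + 1) (N := c - 1) (by lia) (by lia)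
    (hL m) (δ := Δ') (by rw [hN']; exact hΔ')
  rw [hD', hN'] at h
  have hc : (c : ℝ) = N + 1 := by linarith
  have hN0 : 0 < N := by linarith
  have hN2 : 0 < N - 2 := by linarith
  have hD0 : 0 < D := by linarith
  have hK : 0 < K₂ - 1 := by linarith
  rw [← hDdef, ← hNdef, hc]
  have hK1 : 0 < K₁ := by linarith
  have hK2 : 0 < K₂ := by linarith
  have hR : 0 ≤ (1 + Real.exp (2 * Δ' / N) * √((1 + 2 * D / N) * (2 * Δ' / D))) ^ 2 := by
    positivity
  generalize (1 + Real.exp (2 * Δ' / N) * √((1 + 2 * D / N) * (2 * Δ' / D))) ^ 2 = R at *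
  calc K₂ / (K₂ - 1) * max (K₁ * D * (N + 1) / N *
        GaussianModelSelection.EFish (d + 1) (c - 1) (Real.exp (-L m)) - d) 0
      ≤ K₂ / (K₂ - 1) * (K₁ * D * (N + 1) / N * (N / (N - 2) * R)) := by
        gcongr
        -- The term `-d` is simply dropped, and the bound is nonnegative, so the positive part costs
        -- nothing.
        refine max_le ?_ (by positivity)
        have := mul_le_mul_of_nonneg_left h (show 0 ≤ K₁ * D * (N + 1) / N by positivity)
        linarith
    _ = K₁ * K₂ / (K₂ - 1) * ((N + 1) / (N - 2)) * R * D := by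
        field_simp
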